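/- Let $k\ge 3$ be an integer and let $C_0$ be a real constant. For integers $n\ge 1$ and $m$ with $2m\ge kn$, let $G_{\mathrm{multi}}(k,n,m)$ be the random multigraph on $[n]$ obtained by choosing a function $a:[2m]\to[n]$ uniformly at random among all functions with $|a^{-1}(v)|\ge k$ for every $v\in[n]$, and adding, for every $i\in[m]$, an edge joining $a(i)$ and $a(m+i)$ (loops and multiple edges are allowed, and a loop contributes $2$ to the degree of its vertex). The $k$-core of a multigraph is its maximal (possibly empty) subgraph with minimum degree at least $k$. Then there is a constant $\gamma>0$, depending only on $k$ and $C_0$, such that for every $m=m(n)$ with $kn\le 2m\le C_0n$ for all sufficiently large $n$, the following holds with probability tending to $1$ as $n\to\infty$: if $e$ is an edge of $G_{\mathrm{multi}}(k,n,m)$ chosen uniformly at random, then the $k$-core of $G_{\mathrm{multi}}(k,n,m)-e$ either is empty or has at least $\gamma n$ vertices. -/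

import Mathlib

open Filter Topology MeasureTheory ProbabilityTheory

namespace Graph

/-- The degree of a vertex in a multigraph: the number of incident edges, where every loop is
counted twice. -/
noncomputable def deg {α β : Type*} (G : Graph α β) (v : α) : ℕ∞ :=
  (G.incidenceSet v).encard + (G.loopSet v).encard

/-- Every vertex of `G` has degree at least `k`. -/
def MinDegGE {α β : Type*} (k : ℕ) (G : Graph α β) : Prop :=
  ∀ v ∈ G.vertexSet, (k : ℕ∞) ≤ G.deg v

/-- The `k`-core of a multigraph: its largest subgraph with minimum degree at least `k`
(see `isGreatest_kCore`), constructed as the subgraph induced by the union of the vertex sets of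
all subgraphs with minimum degree at least `k`. -/
def kCore {α β : Type*} (k : ℕ) (G : Graph α β) : Graph α β :=
  G.induce {v | ∃ H : Graph α β, H ≤ G ∧ H.MinDegGE k ∧ v ∈ H.vertexSet}

theorem deg_mono {α β : Type*} {H G : Graph α β} (h : H ≤ G) (v : α) : H.deg v ≤ G.deg v :=
  add_le_add (Set.encard_le_encard fun _ he => Inc.mono h he)
    (Set.encard_le_encard fun _ he => IsLoopAt.mono h he)

/-- The `k`-core is the greatest subgraph with minimum degree at least `k`. -/
theorem isGreatest_kCore {α β : Type*} (k : ℕ) (G : Graph α β) :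
    IsGreatest {H : Graph α β | H ≤ G ∧ H.MinDegGE k} (G.kCore k) := by
  have key : ∀ H : Graph α β, H ≤ G → H.MinDegGE k → H ≤ G.kCore k := fun H hH hk =>
    { vertexSet_mono := fun v hv => ⟨H, hH, hk, hv⟩
      isLink_mono := fun e x y h =>
        ⟨h.mono hH, ⟨H, hH, hk, h.left_mem⟩, ⟨H, hH, hk, h.right_mem⟩⟩ }
  refine ⟨⟨induce_le ?_, ?_⟩, fun H hH => key H hH.1 hH.2⟩
  · rintro v ⟨H, hH, -, hv⟩
    exact hH.vertexSet_mono hv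
  · rintro v ⟨H, hH, hk, hv⟩
    exact (hk v hv).trans (deg_mono (key H hH hk) v)

/-- The multigraph on `Fin n` whose `i`-th edge, `i : Fin m`, joins `a i` and `a (m + i)`. -/
def ofAllocation {n m : ℕ} (a : Fin (2 * m) → Fin n) : Graph (Fin n) (Fin m) where
  vertexSet := Set.univ
  IsLink i x y := s(x, y) = s(a ⟨i, by omega⟩, a ⟨m + i, by omega⟩)
  isLink_symm i _ := ⟨fun x y h => by rw [Sym2.eq_swap]; exact h⟩
  eq_or_eq_of_isLink_of_isLink i x y v w h h' := by
    have h₂ := h.trans h'.symm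
    rw [Sym2.eq_iff] at h₂
    tauto
  left_mem_of_isLink _ _ _ _ := Set.mem_univ _

end Graph

/-- The allocations `a` of `2 * m` points to `n` vertices in which every vertex receives at least
`k` points. -/
def coreAllocations (k n m : ℕ) : Set (Fin (2 * m) → Fin n) :=
  {a | ∀ v : Fin n, k ≤ (a ⁻¹' {v}).ncard}

/-- The joint law of a uniformly random allocation in `coreAllocations k n m`, which defines the
random multigraph `Graph.ofAllocation a`, and an independent uniformly random edge `e` of it. -/
noncomputable def allocationEdgeLaw (k n m : ℕ) :
    Measure ((Fin (2 * m) → Fin n) × Fin m) :=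
  uniformOn (coreAllocations k n m ×ˢ Set.univ)

/-! A nonempty `k`-core on a vertex set `S` of size `s` spans at least `ks/2 ≥ 3s/2` edges, before
or after an edge is deleted. So it suffices that with high probability no nonempty set of at most
`γn` vertices is that dense, and the deleted edge plays no role.

This is a first moment argument. If `2t` given points land in `S` with probability at most
`(s/n)^(2t)`, the expected number of `s`-sets spanning `t ≥ 3s/2` edges is at most `C(n,s) C(m,t)
(s/n)^(2t)`, hence at most `(K s/n)^(s/2)`. For small `γ`, summing over `s ≤ γn` gives
`O(n^(-1/2))`.

The bound `(s/n)^(2t)` is immediate for independent points, but here the fibers are conditioned to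
have size at least `k`. `card_pow_mul_card_confined_le` recovers it one point at a time: given that
the points of `P` lie in `S`, vertices of `S` need the remaining points no more than outside
vertices do, so a further point is in `S` with probability at most `s/n`. The comparison is a
swapping argument, `sum_card_filter_le`. -/

/-- The functions `a : ι → V` all of whose fibers have at least `k` elements and which map `P`
into `S`. -/
def confinedAllocations {ι V : Type*} [Fintype ι] [Fintype V] [DecidableEq ι] [DecidableEq V]
    (k : ℕ) (P : Finset ι) (S : Finset V) : Finset (ι → V) :=
  Finset.univ.filter fun a => (∀ v, k ≤ (Finset.univ.filter fun i => a i = v).card) ∧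
    ∀ i ∈ P, a i ∈ S

/-! ### Exchanging two vertices off a set of points -/

section SwapOff

variable {ι V : Type*} [DecidableEq ι] [DecidableEq V]

/-- The map exchanging the values `v` and `w` outside of `P`. -/
def swapOff (P : Finset ι) (v w : V) (a : ι → V) : ι → V :=
  fun i => if i ∈ P then a i else Equiv.swap v w (a i)

theorem swapOff_swapOff (P : Finset ι) (v w : V) (a : ι → V) :
    swapOff P v w (swapOff P v w a) = a := by
  ext i
  by_cases h : i ∈ P <;> simp [swapOff, h]

theorem swapOff_comm (P : Finset ι) (v w : V) : swapOff P v w = swapOff P w v := by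
  ext a i
  simp [swapOff, Equiv.swap_comm]

theorem filter_swapOff_left [Fintype ι] (P : Finset ι) (v w : V) (a : ι → V) :
    (Pᶜ.filter fun i => swapOff P v w a i = v) = Pᶜ.filter fun i => a i = w := by
  refine Finset.filter_congr fun i hi => ?_
  rw [Finset.mem_compl] at hi
  simp [swapOff, hi, Equiv.swap_apply_eq_iff]

theorem filter_swapOff_right [Fintype ι] (P : Finset ι) (v w : V) (a : ι → V) :
    (Pᶜ.filter fun i => swapOff P v w a i = w) = Pᶜ.filter fun i => a i = v := by
  rw [swapOff_comm, filter_swapOff_left]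

end SwapOff

/-! ### Confining points to `S` under the minimum-degree condition -/

section Confined

variable {ι V : Type*} [Fintype ι] [Fintype V] [DecidableEq ι] [DecidableEq V]

theorem mem_confinedAllocations {k : ℕ} {P : Finset ι} {S : Finset V} {a : ι → V} :
    a ∈ confinedAllocations k P S ↔
      (∀ v, k ≤ (Finset.univ.filter fun i => a i = v).card) ∧ ∀ i ∈ P, a i ∈ S := by
  simp [confinedAllocations]

/-- Points outside `P` are exchangeable. -/
theorem card_confined_apply_eq (k : ℕ) (P : Finset ι) (S : Finset V) {p q : ι} (hp : p ∉ P)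
    (hq : q ∉ P) (v : V) :
    ((confinedAllocations k P S).filter fun a => a q = v).card =
      ((confinedAllocations k P S).filter fun a => a p = v).card := by
  have key : ∀ a ∈ confinedAllocations k P S,
      a ∘ Equiv.swap p q ∈ confinedAllocations k P S := by
    intro a ha
    rw [mem_confinedAllocations] at ha ⊢
    refine ⟨fun v => (ha.1 v).trans (Finset.card_le_card_of_injOn (Equiv.swap p q) ?_
      (Equiv.injective _).injOn), fun i hi => ?_⟩
    · intro i hi
      simpa using hi
    · have h1 : i ≠ p := fun h => hp (h ▸ hi)
      have h2 : i ≠ q := fun h => hq (h ▸ hi)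
      simpa [Equiv.swap_apply_of_ne_of_ne h1 h2] using ha.2 i hi
  refine Finset.card_nbij' (fun a => a ∘ Equiv.swap p q) (fun a => a ∘ Equiv.swap p q) ?_ ?_ ?_ ?_
  · intro a ha
    simp only [Finset.coe_filter, Set.mem_ofPred_eq] at ha ⊢
    exact ⟨key a ha.1, by simpa using ha.2⟩
  · intro a ha
    simp only [Finset.coe_filter, Set.mem_ofPred_eq] at ha ⊢
    exact ⟨key a ha.1, by simpa using ha.2⟩
  · intro a _
    ext i
    simp
  · intro a _
    ext i
    simp

/-- Among the points outside `P`, a vertex outside `S` receives on average at least as many as a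
vertex of `S`. -/
theorem sum_card_filter_le (k : ℕ) (P : Finset ι) (S : Finset V) {v w : V} (hv : v ∈ S)
    (hw : w ∉ S) :
    ∑ a ∈ confinedAllocations k P S, (Pᶜ.filter fun i => a i = v).card ≤
      ∑ a ∈ confinedAllocations k P S, (Pᶜ.filter fun i => a i = w).card := by
  set B := confinedAllocations k P S with hB
  -- Where the swap stays in `B`, it is an involution matching the two sums. Elsewhere the
  -- inequality holds for each `a`.
  rw [← Finset.sum_filter_add_sum_filter_not B (fun a => swapOff P v w a ∈ B),
    ← Finset.sum_filter_add_sum_filter_not B (fun a => swapOff P v w a ∈ B)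
      (fun a => (Pᶜ.filter fun i => a i = w).card)]
  refine add_le_add (le_of_eq ?_) (Finset.sum_le_sum fun a ha => ?_)
  · refine Finset.sum_nbij' (swapOff P v w) (swapOff P v w) ?_ ?_ ?_ ?_ ?_
    · intro a ha
      rw [Finset.mem_filter] at ha ⊢
      rw [swapOff_swapOff]
      exact ⟨ha.2, ha.1⟩
    · intro a ha
      rw [Finset.mem_filter] at ha ⊢
      rw [swapOff_swapOff]
      exact ⟨ha.2, ha.1⟩
    · exact fun a _ => swapOff_swapOff P v w a
    · exact fun a _ => swapOff_swapOff P v w a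
    · intro a _
      rw [filter_swapOff_right]
  · rw [Finset.mem_filter] at ha
    obtain ⟨haB, hna⟩ := ha
    rw [hB, mem_confinedAllocations] at haB
    have hoff : ∀ b : ι → V, (∀ i ∈ P, b i ∈ S) →
        (Finset.univ.filter fun i => b i = w) = Pᶜ.filter fun i => b i = w := by
      intro b hb
      ext i
      simp only [Finset.mem_filter, Finset.mem_univ, true_and, Finset.mem_compl]
      exact ⟨fun h => ⟨fun hi => hw (h ▸ hb i hi), h⟩, fun h => h.2⟩
    have hsplit : ∀ (b : ι → V) (u : V), (Finset.univ.filter fun i => b i = u).card =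
        (P.filter fun i => b i = u).card + (Pᶜ.filter fun i => b i = u).card := by
      intro b u
      rw [← Finset.card_union_of_disjoint
        (Finset.disjoint_filter_filter disjoint_compl_right), ← Finset.filter_union,
        Finset.union_compl]
    have hkw : k ≤ (Pᶜ.filter fun i => a i = w).card := hoff a haB.2 ▸ haB.1 w
    -- All points at `w` lie off `P`, so there are at least `k` of them. If `v` had more points off
    -- `P`, both fibers would keep size at least `k` after the swap, which would then stay in `B`.
    by_contra! hlt
    refine hna (hB ▸ mem_confinedAllocations.2 ⟨fun u => ?_, fun i hi => ?_⟩)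
    · rcases eq_or_ne u v with rfl | huv
      · rw [hsplit, filter_swapOff_left]
        omega
      rcases eq_or_ne u w with rfl | huw
      · rw [hsplit, filter_swapOff_right]
        omega
      refine (haB.1 u).trans (Finset.card_le_card fun i hi => ?_)
      simp only [Finset.mem_filter, Finset.mem_univ, true_and] at hi ⊢
      simp [swapOff, hi, Equiv.swap_apply_of_ne_of_ne huv huw]
    · simpa [swapOff, hi] using haB.2 i hi

/-- By exchangeability, the total occupancy off `P` is the number of free points times the count for
a single `p`, so the averaged comparison passes to `p`. -/
theorem card_confined_apply_le (k : ℕ) (P : Finset ι) (S : Finset V) {p : ι} (hp : p ∉ P)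
    {v w : V} (hv : v ∈ S) (hw : w ∉ S) :
    ((confinedAllocations k P S).filter fun a => a p = v).card ≤
      ((confinedAllocations k P S).filter fun a => a p = w).card := by
  have hdc : ∀ u : V, ∑ a ∈ confinedAllocations k P S, (Pᶜ.filter fun i => a i = u).card =
      Pᶜ.card * ((confinedAllocations k P S).filter fun a => a p = u).card := by
    intro u
    simp_rw [Finset.card_filter]
    rw [Finset.sum_comm]
    simp_rw [← Finset.card_filter]
    rw [Finset.sum_congr rfl fun q hq =>
      card_confined_apply_eq k P S hp (Finset.mem_compl.1 hq) u, Finset.sum_const, smul_eq_mul]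
  have h := sum_card_filter_le k P S hv hw
  rw [hdc, hdc] at h
  exact Nat.le_of_mul_le_mul_left h (Finset.card_pos.2 ⟨p, Finset.mem_compl.2 hp⟩)

/-- Summing the comparison over all pairs in `S × Sᶜ` shows that `p` falls in `S` for a proportion
at most `|S|/|V|` of the allocations. -/
theorem card_mul_card_confined_insert_le (k : ℕ) (P : Finset ι) (S : Finset V) {p : ι}
    (hp : p ∉ P) :
    Fintype.card V * (confinedAllocations k (insert p P) S).card ≤
      S.card * (confinedAllocations k P S).card := by
  set B := confinedAllocations k P S with hB
  have h1 : confinedAllocations k (insert p P) S = B.filter fun a => a p ∈ S := by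
    ext a
    rw [hB, Finset.mem_filter, mem_confinedAllocations, mem_confinedAllocations,
      Finset.forall_mem_insert]
    tauto
  have hsum : ∀ T : Finset V, (B.filter fun a => a p ∈ T).card =
      ∑ v ∈ T, (B.filter fun a => a p = v).card := by
    intro T
    simp_rw [Finset.card_filter]
    rw [Finset.sum_comm]
    exact Finset.sum_congr rfl fun a _ => by rw [Finset.sum_ite_eq]
  have hcmp : Sᶜ.card * (B.filter fun a => a p ∈ S).card ≤
      S.card * (B.filter fun a => a p ∈ Sᶜ).card := by
    rw [hsum, hsum, Finset.mul_sum, Finset.mul_sum]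
    calc ∑ v ∈ S, Sᶜ.card * (B.filter fun a => a p = v).card
        = ∑ v ∈ S, ∑ _w ∈ Sᶜ, (B.filter fun a => a p = v).card := by simp
      _ ≤ ∑ _v ∈ S, ∑ w ∈ Sᶜ, (B.filter fun a => a p = w).card :=
          Finset.sum_le_sum fun v hv => Finset.sum_le_sum fun w hw =>
            card_confined_apply_le k P S hp hv (Finset.mem_compl.1 hw)
      _ = _ := by rw [Finset.sum_const, smul_eq_mul, Finset.mul_sum]
  have hBs : B.card = (B.filter fun a => a p ∈ S).card + (B.filter fun a => a p ∈ Sᶜ).card := by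
    rw [← Finset.card_filter_add_card_filter_not (s := B) (fun a => a p ∈ S)]
    simp
  have hV : Fintype.card V = S.card + Sᶜ.card := (Finset.card_add_card_compl S).symm
  rw [h1, hBs, hV, add_mul, mul_add]
  omega

theorem card_pow_mul_card_confined_le (k : ℕ) (P : Finset ι) (S : Finset V) :
    Fintype.card V ^ P.card * (confinedAllocations k P S).card ≤
      S.card ^ P.card * (confinedAllocations (ι := ι) k ∅ S).card := by
  induction P using Finset.induction_on with
  | empty => simp
  | insert p P hp ih =>
    rw [Finset.card_insert_of_notMem hp, pow_succ, pow_succ]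
    calc _ = Fintype.card V ^ P.card *
          (Fintype.card V * (confinedAllocations k (insert p P) S).card) := by ring
      _ ≤ Fintype.card V ^ P.card * (S.card * (confinedAllocations k P S).card) :=
          Nat.mul_le_mul_left _ (card_mul_card_confined_insert_le k P S hp)
      _ = S.card * (Fintype.card V ^ P.card * (confinedAllocations k P S).card) := by ring
      _ ≤ S.card * (S.card ^ P.card * (confinedAllocations (ι := ι) k ∅ S).card) :=
          Nat.mul_le_mul_left _ ih
      _ = _ := by ring

end Confined

/-! ### Dense vertex sets and their first moment -/

section Inner

variable {n m : ℕ}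

/-- The first point of the `i`-th edge. -/
def fstPoint (i : Fin m) : Fin (2 * m) := ⟨i, by omega⟩

/-- The second point of the `i`-th edge. -/
def sndPoint (i : Fin m) : Fin (2 * m) := ⟨m + i, by omega⟩

/-- The edges of `Graph.ofAllocation a` with both ends in `S`. -/
def innerEdges (a : Fin (2 * m) → Fin n) (S : Finset (Fin n)) : Finset (Fin m) :=
  Finset.univ.filter fun i => a (fstPoint i) ∈ S ∧ a (sndPoint i) ∈ S

/-- The points belonging to a set of edges. -/
def edgePoints (E : Finset (Fin m)) : Finset (Fin (2 * m)) :=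
  E.image fstPoint ∪ E.image sndPoint

theorem card_edgePoints (E : Finset (Fin m)) : (edgePoints E).card = 2 * E.card := by
  have h1 : Function.Injective (fstPoint (m := m)) := fun i j h => by
    simpa [fstPoint, Fin.ext_iff] using h
  have h2 : Function.Injective (sndPoint (m := m)) := fun i j h => by
    simpa [sndPoint, Fin.ext_iff] using h
  rw [edgePoints, Finset.card_union_of_disjoint, Finset.card_image_of_injective _ h1,
    Finset.card_image_of_injective _ h2, two_mul]
  simp only [Finset.disjoint_left, Finset.mem_image]
  rintro _ ⟨i, -, rfl⟩ ⟨j, -, h⟩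
  simp only [fstPoint, sndPoint, Fin.ext_iff] at h
  omega

theorem ofAllocation_isLink (a : Fin (2 * m) → Fin n) (i : Fin m) (x y : Fin n) :
    (Graph.ofAllocation a).IsLink i x y ↔ s(x, y) = s(a (fstPoint i), a (sndPoint i)) := Iff.rfl

/-- The degrees of a subgraph are bounded by the number of incidences inside its vertex set. -/
theorem deg_le_of_le_ofAllocation {a : Fin (2 * m) → Fin n} {H : Graph (Fin n) (Fin m)}
    (hH : H ≤ Graph.ofAllocation a) {S : Finset (Fin n)} (hS : H.vertexSet = S) (v : Fin n) :
    H.deg v ≤ (((innerEdges a S).filter fun i => a (fstPoint i) = v).card +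
      ((innerEdges a S).filter fun i => a (sndPoint i) = v).card : ℕ) := by
  have hin : ∀ i x y, H.IsLink i x y →
      i ∈ innerEdges a S ∧ s(x, y) = s(a (fstPoint i), a (sndPoint i)) := by
    intro i x y h
    have h' := (ofAllocation_isLink a i x y).1 (h.mono hH)
    have hx : x ∈ S := by simpa [hS] using h.left_mem
    have hy : y ∈ S := by simpa [hS] using h.right_mem
    refine ⟨?_, h'⟩
    rw [Sym2.eq_iff] at h'
    rcases h' with ⟨rfl, rfl⟩ | ⟨rfl, rfl⟩ <;> simp [innerEdges, hx, hy]
  set X := (innerEdges a S).filter fun i => a (fstPoint i) = v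
  set Y := (innerEdges a S).filter fun i => a (sndPoint i) = v
  have h1 : H.incidenceSet v ⊆ (X ∪ Y : Finset (Fin m)) := by
    rintro i ⟨y, h⟩
    obtain ⟨hi, h'⟩ := hin i _ _ h
    rw [Sym2.eq_iff] at h'
    simp only [X, Y, Finset.coe_union, Set.mem_union, Finset.mem_coe, Finset.mem_filter]
    tauto
  -- A loop at `v` has both points at `v`, so inclusion-exclusion on `X` and `Y` accounts for its
  -- double weight.
  have h2 : H.loopSet v ⊆ (X ∩ Y : Finset (Fin m)) := by
    intro i h
    obtain ⟨hi, h'⟩ := hin i _ _ h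
    rw [Sym2.eq_iff] at h'
    simp only [X, Y, Finset.coe_inter, Set.mem_inter_iff, Finset.mem_coe, Finset.mem_filter]
    have h3 := h'.elim (fun h => h) fun h => ⟨h.2, h.1⟩
    exact ⟨⟨hi, h3.1.symm⟩, hi, h3.2.symm⟩
  calc H.deg v ≤ ((X ∪ Y : Finset (Fin m)) : Set (Fin m)).encard +
        ((X ∩ Y : Finset (Fin m)) : Set (Fin m)).encard :=
        add_le_add (Set.encard_le_encard h1) (Set.encard_le_encard h2)
    _ = ((X.card + Y.card : ℕ) : ℕ∞) := by
        rw [Set.encard_coe_eq_coe_finsetCard, Set.encard_coe_eq_coe_finsetCard, ← Nat.cast_add,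
          Finset.card_union_add_card_inter]

/-- Handshake count: each inner edge has one first and one second point, both in `S`. -/
theorem mul_card_le_two_mul_card_innerEdges {k : ℕ} {a : Fin (2 * m) → Fin n}
    {H : Graph (Fin n) (Fin m)} (hH : H ≤ Graph.ofAllocation a) (hk : H.MinDegGE k)
    {S : Finset (Fin n)} (hS : H.vertexSet = S) : k * S.card ≤ 2 * (innerEdges a S).card := by
  have hdeg : ∀ v ∈ S, k ≤ ((innerEdges a S).filter fun i => a (fstPoint i) = v).card +
      ((innerEdges a S).filter fun i => a (sndPoint i) = v).card := fun v hv =>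
    Nat.cast_le.1 ((hk v (by simpa [hS] using hv)).trans (deg_le_of_le_ofAllocation hH hS v))
  have h := Finset.sum_le_sum hdeg
  rw [Finset.sum_const, smul_eq_mul, Finset.sum_add_distrib,
    ← Finset.card_eq_sum_card_fiberwise, ← Finset.card_eq_sum_card_fiberwise] at h
  · linarith
  · intro i hi
    simp only [innerEdges, Finset.coe_filter, Set.mem_ofPred_eq] at hi
    exact hi.2.2
  · intro i hi
    simp only [innerEdges, Finset.coe_filter, Set.mem_ofPred_eq] at hi
    exact hi.2.1

theorem confinedAllocations_empty (k : ℕ) (S : Finset (Fin n)) :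
    confinedAllocations (ι := Fin (2 * m)) k ∅ S = confinedAllocations k ∅ ∅ := by
  simp [confinedAllocations]

/-- First moment bound for the number of sets of `s` vertices spanning at least `t` edges. -/
theorem card_exists_dense_le (k n m s t : ℕ) :
    n ^ (2 * t) * ((confinedAllocations (ι := Fin (2 * m)) (V := Fin n) k ∅ ∅).filter
      fun a => ∃ S : Finset (Fin n), S.card = s ∧ t ≤ (innerEdges a S).card).card ≤
    n.choose s * m.choose t * s ^ (2 * t) *
      (confinedAllocations (ι := Fin (2 * m)) (V := Fin n) k ∅ ∅).card := by
  set A := confinedAllocations (ι := Fin (2 * m)) (V := Fin n) k ∅ ∅ with hA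
  set I := Finset.powersetCard s (Finset.univ : Finset (Fin n)) ×ˢ
    Finset.powersetCard t (Finset.univ : Finset (Fin m)) with hI
  have hsub : (A.filter fun a => ∃ S : Finset (Fin n), S.card = s ∧ t ≤ (innerEdges a S).card) ⊆
      I.biUnion fun x => confinedAllocations k (edgePoints x.2) x.1 := by
    intro a ha
    rw [Finset.mem_filter, hA, mem_confinedAllocations] at ha
    obtain ⟨⟨ha, -⟩, S, hS, ht⟩ := ha
    obtain ⟨E, hE, rfl⟩ := Finset.exists_subset_card_eq ht
    refine Finset.mem_biUnion.2 ⟨(S, E), by simp [hI, hS],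
      mem_confinedAllocations.2 ⟨ha, fun p hp => ?_⟩⟩
    rw [edgePoints, Finset.mem_union, Finset.mem_image, Finset.mem_image] at hp
    rcases hp with ⟨i, hi, rfl⟩ | ⟨i, hi, rfl⟩
    · exact (Finset.mem_filter.1 (hE hi)).2.1
    · exact (Finset.mem_filter.1 (hE hi)).2.2
  calc _ ≤ n ^ (2 * t) * ∑ x ∈ I, (confinedAllocations k (edgePoints x.2) x.1).card :=
        Nat.mul_le_mul_left _ ((Finset.card_le_card hsub).trans Finset.card_biUnion_le)
    _ = ∑ x ∈ I, n ^ (2 * t) * (confinedAllocations k (edgePoints x.2) x.1).card :=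
        Finset.mul_sum _ _ _
    _ ≤ ∑ _x ∈ I, s ^ (2 * t) * A.card := by
        refine Finset.sum_le_sum fun x hx => ?_
        rw [hI, Finset.mem_product, Finset.mem_powersetCard, Finset.mem_powersetCard] at hx
        have h := card_pow_mul_card_confined_le k (edgePoints x.2) x.1
        rwa [card_edgePoints, hx.1.2, hx.2.2, Fintype.card_fin, confinedAllocations_empty] at h
    _ = _ := by
        rw [Finset.sum_const, hI, Finset.card_product, Finset.card_powersetCard,
          Finset.card_powersetCard, Finset.card_univ, Finset.card_univ, Fintype.card_fin,
          Fintype.card_fin, smul_eq_mul]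
        ring

end Inner

/-! ### Numerical estimates -/

theorem choose_le_exp_mul_div_pow (n s : ℕ) (hs : 1 ≤ s) :
    (n.choose s : ℝ) ≤ (Real.exp 1 * n / s) ^ s := by
  have hs0 : (0 : ℝ) < s := by exact_mod_cast hs
  have h1 := Nat.choose_le_pow_div (α := ℝ) s n
  have h2 := Real.pow_div_factorial_le_exp (x := (s : ℝ)) hs0.le s
  have hf : (0 : ℝ) < s.factorial := by exact_mod_cast s.factorial_pos
  have h3 : Real.exp (s : ℝ) = Real.exp 1 ^ s := by rw [← Real.exp_nat_mul, mul_one]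
  rw [h3, div_le_iff₀ hf] at h2
  refine h1.trans ?_
  rw [div_pow, mul_pow, div_le_div_iff₀ hf (by positivity)]
  calc (n : ℝ) ^ s * (s : ℝ) ^ s ≤ (n : ℝ) ^ s * (Real.exp 1 ^ s * s.factorial) := by gcongr
    _ = _ := by ring

/-- The first moment estimate: the right-hand side is `(√(K s / n)) ^ s` for a constant `K`. -/
theorem choose_mul_choose_mul_pow_le {C : ℝ} (hC : 1 ≤ C) {n m s t : ℕ} (hn : 1 ≤ n)
    (hs : 1 ≤ s) (ht : 3 * s ≤ 2 * t) (hm : (2 * m : ℝ) ≤ C * n)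
    (hsn : Real.exp 1 * C * s ≤ n) :
    (n.choose s : ℝ) * m.choose t * (s / n : ℝ) ^ (2 * t) ≤
      (Real.exp 1 * (Real.exp 1 * C) * √(Real.exp 1 * C * s / n)) ^ s := by
  have hs0 : (0 : ℝ) < s := by exact_mod_cast hs
  have hn0 : (0 : ℝ) < n := by exact_mod_cast hn
  have ht1 : 1 ≤ t := by omega
  have ht0 : (0 : ℝ) < t := by exact_mod_cast ht1
  have hst : (3 * s : ℝ) ≤ 2 * t := by exact_mod_cast ht
  set D := Real.exp 1 * C with hD
  have hD0 : 0 < D := by positivity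
  have hmt : Real.exp 1 * m / t ≤ D * n / s := by
    rw [div_le_div_iff₀ ht0 hs0, hD, mul_assoc, mul_assoc, mul_assoc]
    refine mul_le_mul_of_nonneg_left ?_ (Real.exp_pos 1).le
    have h1 : (2 * m : ℝ) * s ≤ C * n * s := by gcongr
    have h2 : C * n * (3 * s) ≤ C * n * (2 * t) := by gcongr
    have h3 : 0 ≤ C * n * s := by positivity
    linarith
  set y := D * s / n with hy
  have hy0 : 0 ≤ y := by positivity
  have hy1 : √y ≤ 1 := Real.sqrt_le_one.2 ((div_le_one hn0).2 hsn)
  calc (n.choose s : ℝ) * m.choose t * (s / n : ℝ) ^ (2 * t)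
      ≤ (Real.exp 1 * n / s) ^ s * (D * n / s) ^ t * (s / n : ℝ) ^ (2 * t) := by
        gcongr
        · exact choose_le_exp_mul_div_pow n s hs
        · exact (choose_le_exp_mul_div_pow m t ht1).trans (by gcongr)
    _ = (Real.exp 1 * n / s) ^ s * √y ^ (2 * t) := by
        rw [mul_assoc, pow_mul, pow_mul (√y), Real.sq_sqrt hy0, ← mul_pow, hy]
        congr 2
        field_simp
    -- Working with `√y ≤ 1` lets the exponent drop from `2t` to `3s` whatever the parity of `s`.
    _ ≤ (Real.exp 1 * n / s) ^ s * √y ^ (3 * s) := by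
        refine mul_le_mul_of_nonneg_left ?_ (by positivity)
        exact pow_le_pow_of_le_one (Real.sqrt_nonneg _) hy1 ht
    _ = (Real.exp 1 * D * √y) ^ s := by
        rw [pow_mul, ← mul_pow, pow_succ, Real.sq_sqrt hy0]
        congr 1
        rw [hy]
        field_simp

theorem sum_nat_mul_quarter_pow_le (N : ℕ) :
    ∑ s ∈ Finset.range N, (s + 1 : ℝ) * (1 / 4) ^ s ≤ 2 := by
  have h : ∀ s ∈ Finset.range N, (s + 1 : ℝ) * (1 / 4) ^ s ≤ (1 / 2) ^ s := by
    intro s _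
    have h1 : (s + 1 : ℝ) ≤ 2 ^ s := by exact_mod_cast Nat.lt_two_pow_self
    calc (s + 1 : ℝ) * (1 / 4) ^ s ≤ 2 ^ s * (1 / 4) ^ s := by gcongr
      _ = (1 / 2) ^ s := by rw [← mul_pow]; norm_num
  exact (Finset.sum_le_sum h).trans (sum_geometric_two_le N)

/-- The proportion of allocations with a dense set of fewer than `γ n` vertices. -/
theorem card_exists_small_dense_le {C : ℝ} (hC : 1 ≤ C) (k : ℕ) {n m : ℕ} (hn : 1 ≤ n)
    (hm : (2 * m : ℝ) ≤ C * n) :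
    (((confinedAllocations (ι := Fin (2 * m)) (V := Fin n) k ∅ ∅).filter
      fun a => ∃ S : Finset (Fin n), 1 ≤ S.card ∧
        16 * (Real.exp 1 ^ 2 * (Real.exp 1 * C) ^ 3) * S.card ≤ n ∧
        3 * S.card ≤ 2 * (innerEdges a S).card).card : ℝ) ≤
    2 * (Real.exp 1 * (Real.exp 1 * C) * √(Real.exp 1 * C) / √n) *
      (confinedAllocations (ι := Fin (2 * m)) (V := Fin n) k ∅ ∅).card := by
  classical
  set A := confinedAllocations (ι := Fin (2 * m)) (V := Fin n) k ∅ ∅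
  have he : 1 ≤ Real.exp 1 := Real.one_le_exp zero_le_one
  set D := Real.exp 1 * C with hD
  have hD1 : 1 ≤ D := one_le_mul_of_one_le_of_one_le he hC
  set L := Real.exp 1 ^ 2 * D ^ 3 with hL
  have hn0 : (0 : ℝ) < n := by exact_mod_cast hn
  set q := Real.exp 1 * D * √D / √n with hq
  have hq0 : 0 ≤ q := by positivity
  -- The index is shifted to sizes `s + 1 ≥ 1`, and the edge threshold is `3(s + 1)/2` rounded up.
  let F : ℕ → Finset (Fin (2 * m) → Fin n) := fun s =>
    A.filter fun a => 16 * L * (s + 1 : ℕ) ≤ n ∧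
      ∃ S : Finset (Fin n), S.card = s + 1 ∧ (3 * (s + 1) + 1) / 2 ≤ (innerEdges a S).card
  have hsub : (A.filter fun a => ∃ S : Finset (Fin n), 1 ≤ S.card ∧ 16 * L * S.card ≤ n ∧
      3 * S.card ≤ 2 * (innerEdges a S).card) ⊆ (Finset.range n).biUnion F := by
    intro a ha
    rw [Finset.mem_filter] at ha
    obtain ⟨haA, S, h1, h2, h3⟩ := ha
    have h4 : S.card ≤ n := (Finset.card_le_univ S).trans_eq (Fintype.card_fin n)
    obtain ⟨s, hs⟩ : ∃ s, S.card = s + 1 := ⟨S.card - 1, by omega⟩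
    refine Finset.mem_biUnion.2 ⟨s, Finset.mem_range.2 (by omega), Finset.mem_filter.2
      ⟨haA, hs ▸ h2, S, hs, by omega⟩⟩
  have hF : ∀ s ∈ Finset.range n, ((F s).card : ℝ) ≤ q * A.card * ((s + 1 : ℝ) * (1 / 4) ^ s) := by
    intro s _
    by_cases hsn : 16 * L * (s + 1 : ℕ) ≤ n
    swap
    · have : F s = ∅ := Finset.filter_eq_empty_iff.2 fun a _ h => hsn h.1
      rw [this, Finset.card_empty, Nat.cast_zero]
      positivity
    have hs0 : (0 : ℝ) < (s + 1 : ℕ) := by positivity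
    have hDL : D ≤ 16 * L := by
      have h1 : D ≤ D ^ 3 := le_self_pow₀ hD1 (by norm_num)
      have h2 : D ^ 3 ≤ L := le_mul_of_one_le_left (by positivity) (one_le_pow₀ he)
      have h3 : 0 ≤ L := by positivity
      linarith
    have hfst : n ^ (2 * ((3 * (s + 1) + 1) / 2)) * (F s).card ≤ _ :=
      (Nat.mul_le_mul_left _ (Finset.card_le_card (Finset.monotone_filter_right A
        fun a _ h => h.2))).trans
          (card_exists_dense_le k n m (s + 1) ((3 * (s + 1) + 1) / 2))
    set t := (3 * (s + 1) + 1) / 2 with ht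
    have hest := choose_mul_choose_mul_pow_le hC (s := s + 1) (t := t) hn (by omega) (by omega) hm
      ((mul_le_mul_of_nonneg_right hDL hs0.le).trans hsn)
    rw [← hD] at hest
    set z := Real.exp 1 * D * √(D * (s + 1 : ℕ) / n) with hz
    have hz0 : 0 ≤ z := by positivity
    -- Squared, this is `L(s + 1)/n ≤ 1/16`, which is where the factor 16 in `γ` comes from.
    have hz4 : z ≤ 1 / 4 := by
      refine abs_le_of_sq_le_sq' ?_ (by norm_num) |>.2
      rw [hz, mul_pow, Real.sq_sqrt (by positivity)]
      have : (Real.exp 1 * D) ^ 2 * (D * (s + 1 : ℕ) / n) = L * (s + 1 : ℕ) / n := by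
        rw [hL]; ring
      rw [this, div_le_iff₀ hn0]
      linarith
    -- One factor of `z ^ (s + 1)` is kept for the decay `q = O(n^(-1/2))`; the others give the
    -- geometric series.
    have hzq : z ≤ q * (s + 1) := by
      have h1 : z = q * √(s + 1 : ℕ) := by
        rw [hz, hq, Real.sqrt_div (by positivity), Real.sqrt_mul (by positivity)]
        ring
      rw [h1]
      refine mul_le_mul_of_nonneg_left ?_ hq0
      rw [Real.sqrt_le_left (by positivity)]
      push_cast
      nlinarith [(Nat.cast_nonneg s : (0 : ℝ) ≤ s)]
    have hcast : (n : ℝ) ^ (2 * t) * (F s).card ≤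
        n.choose (s + 1) * m.choose t * ((s + 1 : ℕ) : ℝ) ^ (2 * t) * A.card := by
      exact_mod_cast hfst
    have hnp : (0 : ℝ) < (n : ℝ) ^ (2 * t) := by positivity
    calc ((F s).card : ℝ) ≤
          n.choose (s + 1) * m.choose t * ((s + 1 : ℕ) / n : ℝ) ^ (2 * t) * A.card := by
          rw [div_pow, mul_div_assoc', div_mul_eq_mul_div, le_div_iff₀ hnp]
          linarith
      _ ≤ z ^ (s + 1) * A.card := by gcongr
      _ = z ^ s * z * A.card := by rw [pow_succ]
      _ ≤ (1 / 4) ^ s * (q * (s + 1)) * A.card := by gcongr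
      _ = _ := by ring
  calc _ ≤ (((Finset.range n).biUnion F).card : ℝ) := by exact_mod_cast Finset.card_le_card hsub
    _ ≤ ∑ s ∈ Finset.range n, ((F s).card : ℝ) := by exact_mod_cast Finset.card_biUnion_le
    _ ≤ ∑ s ∈ Finset.range n, q * A.card * ((s + 1 : ℝ) * (1 / 4) ^ s) := Finset.sum_le_sum hF
    _ = q * A.card * ∑ s ∈ Finset.range n, (s + 1 : ℝ) * (1 / 4) ^ s := by rw [Finset.mul_sum]
    _ ≤ q * A.card * 2 := by gcongr; exact sum_nat_mul_quarter_pow_le n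
    _ = _ := by ring

/-! ### From counting to probability -/

theorem coreAllocations_eq_coe (k n m : ℕ) :
    coreAllocations k n m =
      (confinedAllocations (ι := Fin (2 * m)) (V := Fin n) k ∅ ∅ : Finset _) := by
  ext a
  have h : ∀ v, (a ⁻¹' {v}).ncard = (Finset.univ.filter fun i => a i = v).card := by
    intro v
    rw [← Set.ncard_coe_finset]
    congr 1
    ext i
    simp
  simp [coreAllocations, mem_confinedAllocations, h]

/-- Round-robin allocation `i ↦ i mod n`: vertex `v` receives the points `v + jn` for `j < k`. -/
theorem coreAllocations_nonempty {k n m : ℕ} (hn : 1 ≤ n) (h : k * n ≤ 2 * m) :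
    (coreAllocations k n m).Nonempty := by
  refine ⟨fun i => ⟨i % n, Nat.mod_lt _ hn⟩, fun v => ?_⟩
  have hlt : ∀ j : Fin k, v.val + j.val * n < 2 * m := fun j => by
    have h1 : (j.val + 1) * n ≤ k * n := Nat.mul_le_mul_right _ j.2
    have h2 := v.2
    rw [add_mul] at h1
    omega
  have hinj : Function.Injective fun j : Fin k => (⟨v.val + j.val * n, hlt j⟩ : Fin (2 * m)) := by
    intro i j hij
    simp only [Fin.mk.injEq, add_right_inj] at hij
    exact Fin.ext (Nat.eq_of_mul_eq_mul_right hn hij)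
  calc k = (Set.range fun j : Fin k => (⟨v.val + j.val * n, hlt j⟩ : Fin (2 * m))).ncard := by
        rw [← Set.image_univ, Set.ncard_image_of_injective _ hinj, Set.ncard_univ,
          Nat.card_fin]
    _ ≤ _ := by
        refine Set.ncard_le_ncard ?_ (Set.toFinite _)
        rintro _ ⟨j, rfl⟩
        simp [Nat.mod_eq_of_lt v.2]

/-- The event that deleting the chosen edge leaves a nonempty `k`-core of fewer than `γ n`
vertices has probability `O(n ^ (-1 / 2))`. -/
theorem allocationEdgeLaw_small_core_le {C : ℝ} (hC : 1 ≤ C) {k n m : ℕ} (hk : 3 ≤ k)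
    (hn : 1 ≤ n) (hm : (2 * m : ℝ) ≤ C * n) :
    allocationEdgeLaw k n m
      {p | (((Graph.ofAllocation p.1).deleteEdges {p.2}).kCore k).vertexSet = ∅ ∨
        1 / (16 * (Real.exp 1 ^ 2 * (Real.exp 1 * C) ^ 3)) * n ≤
          ((((Graph.ofAllocation p.1).deleteEdges {p.2}).kCore k).vertexSet.ncard : ℝ)}ᶜ ≤
      ENNReal.ofReal (2 * (Real.exp 1 * (Real.exp 1 * C) * √(Real.exp 1 * C) / √n)) := by
  set A := confinedAllocations (ι := Fin (2 * m)) (V := Fin n) k ∅ ∅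
  have hcount := card_exists_small_dense_le hC k hn hm
  set B := A.filter fun a => ∃ S : Finset (Fin n), 1 ≤ S.card ∧
    16 * (Real.exp 1 ^ 2 * (Real.exp 1 * C) ^ 3) * S.card ≤ n ∧
    3 * S.card ≤ 2 * (innerEdges a S).card
  set r := 2 * (Real.exp 1 * (Real.exp 1 * C) * √(Real.exp 1 * C) / √n)
  set L := 16 * (Real.exp 1 ^ 2 * (Real.exp 1 * C) ^ 3) with hL
  have hL0 : 0 < L := by positivity
  have hr0 : 0 ≤ r := by positivity
  have hs : coreAllocations k n m ×ˢ Set.univ =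
      ((A ×ˢ (Finset.univ : Finset (Fin m)) : Finset _) :
        Set ((Fin (2 * m) → Fin n) × Fin m)) := by
    rw [Finset.coe_product, Finset.coe_univ, coreAllocations_eq_coe]
  rw [allocationEdgeLaw, hs, uniformOn, cond_apply (Finset.measurableSet _),
    Measure.count_apply_finset, ← ENNReal.div_eq_inv_mul]
  refine ENNReal.div_le_of_le_mul ?_
  -- The bad event lies in `B` times all edges: a small core is dense in the full multigraph,
  -- whichever edge was deleted.
  refine (measure_mono (t := ((B ×ˢ (Finset.univ : Finset (Fin m)) : Finset _) :
    Set ((Fin (2 * m) → Fin n) × Fin m))) ?_).trans ?_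
  · rintro ⟨a, e⟩ ⟨ha, hbad⟩
    simp only [Set.mem_compl_iff, Set.mem_ofPred_eq, not_or, not_le] at hbad
    obtain ⟨hne, hlt⟩ := hbad
    simp only [Finset.coe_product, Set.mem_prod, Finset.mem_coe] at ha ⊢
    refine ⟨?_, Finset.mem_univ _⟩
    set H := ((Graph.ofAllocation a).deleteEdges {e}).kCore k
    have hgr := (((Graph.ofAllocation a).deleteEdges {e}).isGreatest_kCore k).1
    have hV : ((H.vertexSet.toFinite.toFinset : Finset (Fin n)) : Set (Fin n)) = H.vertexSet :=
      Set.Finite.coe_toFinset _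
    set S := H.vertexSet.toFinite.toFinset
    have hle := mul_card_le_two_mul_card_innerEdges
      (hgr.1.trans Graph.deleteEdges_le) hgr.2 (S := S) hV.symm
    rw [← hV, Set.ncard_coe_finset] at hlt
    rw [← hV] at hne
    refine Finset.mem_filter.2 ⟨ha.1, S, ?_, ?_, (Nat.mul_le_mul_right _ hk).trans hle⟩
    · exact Finset.card_pos.2 (Finset.nonempty_iff_ne_empty.2 fun h => hne (by simp [h]))
    · rw [div_mul_eq_mul_div, one_mul, lt_div_iff₀ hL0] at hlt
      linarith
  · rw [Measure.count_apply_finset, Finset.card_product, Finset.card_product, Nat.cast_mul,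
      Nat.cast_mul, ← mul_assoc]
    gcongr
    rw [← ENNReal.ofReal_natCast, ← ENNReal.ofReal_natCast, ← ENNReal.ofReal_mul hr0]
    exact ENNReal.ofReal_le_ofReal hcount

theorem mainTheorem7 (k : ℕ) (hk : 3 ≤ k) (C₀ : ℝ) :
    ∃ γ : ℝ, 0 < γ ∧ ∀ m : ℕ → ℕ,
      (∀ᶠ n : ℕ in atTop, k * n ≤ 2 * m n ∧ (2 * m n : ℝ) ≤ C₀ * n) →
      Tendsto
        (fun n : ℕ => allocationEdgeLaw k n (m n)
          {p | (((Graph.ofAllocation p.1).deleteEdges {p.2}).kCore k).vertexSet = ∅ ∨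
            γ * n ≤
              ((((Graph.ofAllocation p.1).deleteEdges {p.2}).kCore k).vertexSet.ncard : ℝ)})
        atTop (𝓝 1) := by
  -- The estimates need `C ≥ 1`, while `C₀` is arbitrary.
  set C := max C₀ 1
  have hC : 1 ≤ C := le_max_right _ _
  refine ⟨1 / (16 * (Real.exp 1 ^ 2 * (Real.exp 1 * C) ^ 3)), by positivity, fun m hm => ?_⟩
  have hlim : Tendsto (fun n : ℕ => 1 - ENNReal.ofReal
      (2 * (Real.exp 1 * (Real.exp 1 * C) * √(Real.exp 1 * C) / √n))) atTop (𝓝 1) := by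
    have h1 : Tendsto (fun n : ℕ => √(n : ℝ)) atTop atTop :=
      Real.tendsto_sqrt_atTop.comp tendsto_natCast_atTop_atTop
    have h2 := ENNReal.tendsto_ofReal ((h1.const_div_atTop
      (Real.exp 1 * (Real.exp 1 * C) * √(Real.exp 1 * C))).const_mul 2)
    simpa using ENNReal.Tendsto.sub (tendsto_const_nhds (x := (1 : ENNReal))) h2
      (Or.inl ENNReal.one_ne_top)
  have hprob : ∀ᶠ n : ℕ in atTop, 1 ≤ n ∧ (2 * m n : ℝ) ≤ C * n ∧
      (coreAllocations k n (m n) ×ˢ (Set.univ : Set (Fin (m n)))).Nonempty := by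
    filter_upwards [hm, eventually_ge_atTop 1] with n hn hn1
    have hmpos : 0 < m n := by
      have : 3 * 1 ≤ k * n := Nat.mul_le_mul hk hn1
      omega
    refine ⟨hn1, hn.2.trans (by gcongr; exact le_max_left _ _),
      (coreAllocations_nonempty hn1 hn.1).prod ⟨⟨0, hmpos⟩, Set.mem_univ _⟩⟩
  refine tendsto_of_tendsto_of_tendsto_of_le_of_le' hlim tendsto_const_nhds ?_ ?_
  · filter_upwards [hprob] with n ⟨hn1, hmn, hne⟩
    rw [tsub_le_iff_right]
    refine le_trans (le_of_eq ?_)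
      (add_le_add_right (allocationEdgeLaw_small_core_le hC hk hn1 hmn) _)
    exact (uniformOn_compl _ (Set.toFinite _) hne).symm
  · filter_upwards [hprob] with n ⟨_, _, hne⟩
    have : IsProbabilityMeasure (allocationEdgeLaw k n (m n)) :=
      isProbabilityMeasure_uniformOn (Set.toFinite _) hne
    exact prob_le_one
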